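/- Conventions. Let $Q$ be a finite set of $n$ qubits. A stabilizer code $C(\mathcal S)$ on $Q$ with specified generating set $\mathcal S$ is given by a set $\mathcal S$ of $n$-qubit Pauli operators (phases $\pm1,\pm i$ allowed) generating an abelian group $\langle\mathcal S\rangle$ with $-I\notin\langle\mathcal S\rangle$; $\mathcal S$ may be redundant. The code space is the common $+1$ eigenspace of $\langle\mathcal S\rangle$ in $(\mathbb C^2)^{\otimes n}$. The code has parameters $[[n,k,d]]$ if the code space has dimension $2^k$ and $d$ is the minimum weight of a nontrivial logical operator, i.e. of a Pauli operator that commutes with every element of $\mathcal S$ and is not, up to a phase, in $\langle\mathcal S\rangle$ (such operators are required to exist, so $k\ge 1$). The connectivity graph $G(\mathcal S)$ has vertex set $Q$, two distinct qubits being adjacent if and only if both lie in the support of some generator in $\mathcal S$. Connected graphs carry the shortest-path distance, and $N_q(R)=\{p: d(p,q)\le R\}$, $\partial N_q(R)=\{p: d(p,q)=R\}$. The Assouad dimension of a family $\{G_\lambda\}_{\lambda\in I}$ of connected graphs is the infimum of all real $s$ for which there is a constant $c>0$ such that for all $\lambda\in I$, all vertices $q$ of $G_\lambda$ and all real $0<r<R$,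 the ball $N_q(R)$ can be covered by at most $c\,(R/r)^s$ balls of radius $r$ ($+\infty$ if there is no such $s$). The intrinsic dimension of a family of stabilizer codes with specified generating sets and connected connectivity graphs is the Assouad dimension of the family of these graphs. For constants $0<v_*\le v^*$, the family $\{G_\lambda\}$ satisfies strengthened Ahlfors $\beta$-regularity with constants $v_*,v^*$ up to scale $R_\lambda$ if for all $\lambda\in I$, all vertices $q$ of $G_\lambda$ and all integers $1\le R\le R_\lambda$, $$v_*R^{\beta-1}\le|\partial N_q(R)|\le\max\{v^*R^{\beta-1},1\}.$$ Theorem (Intrinsic code parameter bound). Let $\{C_\lambda(\mathcal S_\lambda)\}_{\lambda\in I}$ be a family of stabilizer codes with specified generating sets and parameters $[[n_\lambda,k_\lambda,d_\lambda]]$, whose connectivity graphs $G_\lambda$ are connected, and suppose that the family has intrinsic dimension $\beta$ with $2\le\beta<\infty$. If $\{G_\lambda\}$ satisfies strengthened Ahlfors $\beta$-regularity with constants $0<v_*\le v^*$ up to scale $d_\lambda$, then for every $\lambda\in I$ $$k_\lambda\, d_\lambda^{\frac{2}{\beta-1}}\ \le\ 18\cdot 400^{\beta}\,\beta\,\frac{(v^*)^{\frac{3\beta-1}{\beta-1}}}{v_*^{3}}\;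 n_\lambda .$$ In particular, there is a constant $w>0$ depending only on $\beta,v_*,v^*$ such that $w\,k_\lambda\, d_\lambda^{\frac{2}{\beta-1}}\le n_\lambda$ for every such family and every $\lambda\in I$. -/

import Mathlib

/-- An element of the Pauli group on the finite set of qubits `Q`:
`⟨a, x, z⟩` stands for the operator `i ^ a • ⨂_q X ^ (x q) * Z ^ (z q)`
(so `Y = i X Z` is `⟨1, 1, 1⟩` on one qubit).  Every Pauli operator with a phase in
`{1, i, -1, -i}` is represented exactly once. -/
@[ext]
structure PauliGroup (Q : Type*) where
  phase : ZMod 4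
  x : Q → ZMod 2
  z : Q → ZMod 2

namespace PauliGroup

/-- The sign `(-1) ^ b = i ^ (2 b)`, recorded as an exponent of `i`. -/
def signExp (b : ZMod 2) : ZMod 4 := 2 * (b.val : ZMod 4)

theorem signExp_add (a b : ZMod 2) : signExp (a + b) = signExp a + signExp b := by
  revert a b; decide

theorem signExp_zero : signExp 0 = 0 := by decide

theorem signExp_add_self (a : ZMod 2) : signExp a + signExp a = 0 := by
  revert a; decide

theorem add_self (a : ZMod 2) : a + a = 0 := by
  revert a; decide

variable {Q : Type*}

instance : One (PauliGroup Q) where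
  one := ⟨0, 0, 0⟩

@[simp] theorem one_phase : (1 : PauliGroup Q).phase = 0 := rfl
@[simp] theorem one_x : (1 : PauliGroup Q).x = 0 := rfl
@[simp] theorem one_z : (1 : PauliGroup Q).z = 0 := rfl

variable [Fintype Q]

/-- Multiplication of Pauli operators: moving `Z ^ z` past `X ^ x'` produces `(-1) ^ (z x')`. -/
instance : Mul (PauliGroup Q) where
  mul P P' := ⟨P.phase + P'.phase + ∑ q, signExp (P.z q * P'.x q), P.x + P'.x, P.z + P'.z⟩

instance : Inv (PauliGroup Q) where
  inv P := ⟨-P.phase + ∑ q, signExp (P.z q * P.x q), P.x, P.z⟩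

@[simp] theorem mul_phase (P P' : PauliGroup Q) :
    (P * P').phase = P.phase + P'.phase + ∑ q, signExp (P.z q * P'.x q) := rfl
@[simp] theorem mul_x (P P' : PauliGroup Q) : (P * P').x = P.x + P'.x := rfl
@[simp] theorem mul_z (P P' : PauliGroup Q) : (P * P').z = P.z + P'.z := rfl
@[simp] theorem inv_phase (P : PauliGroup Q) :
    (P⁻¹).phase = -P.phase + ∑ q, signExp (P.z q * P.x q) := rfl
@[simp] theorem inv_x (P : PauliGroup Q) : (P⁻¹).x = P.x := rfl
@[simp] theorem inv_z (P : PauliGroup Q) : (P⁻¹).z = P.z := rfl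

instance : Group (PauliGroup Q) where
  mul_assoc P P' P'' := by
    ext
    · simp only [mul_phase, mul_x, mul_z, Pi.add_apply, add_mul, mul_add, signExp_add,
        Finset.sum_add_distrib]
      ring
    · simp [add_assoc]
    · simp [add_assoc]
  one_mul P := by
    ext <;> simp [signExp_zero]
  mul_one P := by
    ext <;> simp [signExp_zero]
  inv_mul_cancel P := by
    ext
    · have h : (∑ q, signExp (P.z q * P.x q)) + ∑ q, signExp (P.z q * P.x q) = 0 := by
        rw [← Finset.sum_add_distrib]
        exact Finset.sum_eq_zero fun q _ => signExp_add_self _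
      simp only [mul_phase, inv_phase, inv_z, one_phase]
      linear_combination h
    · simp [add_self]
    · simp [add_self]

/-- The scalar operator `i ^ a`. -/
def scalar (a : ZMod 4) : PauliGroup Q := ⟨a, 0, 0⟩

/-- The qubits on which `P` acts non-trivially. -/
def support (P : PauliGroup Q) : Finset Q := {q | P.x q ≠ 0 ∨ P.z q ≠ 0}

/-- The weight of `P`, i.e. the size of its support. -/
def weight (P : PauliGroup Q) : ℕ := P.support.card

/-- The single-qubit operator `X ^ a * Z ^ b`. -/
def pauliFactor (a b : ZMod 2) : Matrix (Fin 2) (Fin 2) ℂ :=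
  !![0, 1; 1, 0] ^ a.val * !![1, 0; 0, -1] ^ b.val

/-- The operator represented by `P` on the Hilbert space `(ℂ²)^{⊗ Q}`, written in the
computational basis, which is indexed by `Q → Fin 2`. -/
noncomputable def toMatrix (P : PauliGroup Q) : Matrix (Q → Fin 2) (Q → Fin 2) ℂ :=
  Matrix.of fun a b => Complex.I ^ P.phase.val * ∏ q, pauliFactor (P.x q) (P.z q) (a q) (b q)

set_option linter.unusedSectionVars false

theorem I_pow_val_add (a b : ZMod 4) :
    Complex.I ^ (a + b).val = Complex.I ^ a.val * Complex.I ^ b.val := by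
  rw [← pow_add, ZMod.val_add, ← Complex.I_pow_eq_pow_mod]

theorem I_pow_val_sum {ι : Type*} (s : Finset ι) (f : ι → ZMod 4) :
    Complex.I ^ (∑ q ∈ s, f q).val = ∏ q ∈ s, Complex.I ^ (f q).val := by
  classical
  induction s using Finset.induction_on with
  | empty => simp
  | insert a s ha ih => rw [Finset.sum_insert ha, Finset.prod_insert ha, I_pow_val_add, ih]

theorem pauliFactor_mul (a b c e : ZMod 2) : pauliFactor a b * pauliFactor c e =
   (Complex.I ^ (signExp (b*c)).val) • pauliFactor (a+c) (b+e) := by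
  have h4 : (2:ZMod 4).val = 2 := rfl
  have h2 : (1:ZMod 2).val = 1 := rfl
  have h11 : (1:ZMod 2)+1 = 0 := rfl
  have key : ∀ a : ZMod 2, a = 0 ∨ a = 1 := by decide
  rcases key a with rfl | rfl <;> rcases key b with rfl | rfl <;> rcases key c with rfl | rfl <;> rcases key e with rfl | rfl <;>
  · ext i j
    fin_cases i <;> fin_cases j <;> simp [pauliFactor, signExp, Matrix.mul_apply, Fin.sum_univ_two, h4, h2, h11] 

/-- The group law is the composition of operators. -/
theorem toMatrix_mul [DecidableEq Q] (P P' : PauliGroup Q) :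
   toMatrix (P * P') = toMatrix P * toMatrix P' := by
  ext a b
  simp only [toMatrix, Matrix.mul_apply, Matrix.of_apply, mul_phase, mul_x, mul_z, I_pow_val_add, I_pow_val_sum, Pi.add_apply]
  have : ∀ q, ∑ c : Fin 2, pauliFactor (P.x q) (P.z q) (a q) c * pauliFactor (P'.x q) (P'.z q) c (b q) = Complex.I ^ (signExp (P.z q * P'.x q)).val * pauliFactor (P.x q + P'.x q) (P.z q + P'.z q) (a q) (b q) := by
    intro q
    rw [← Matrix.mul_apply, pauliFactor_mul]; rfl
  rw [mul_assoc _ (∏ _, _), ← Finset.prod_mul_distrib]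
  simp only [← this]
  rw [Finset.prod_univ_sum, Finset.mul_sum]
  simp only [Fintype.piFinset_univ, Finset.prod_mul_distrib]
  refine Finset.sum_congr rfl fun _ _ => by ring

end PauliGroup

/-- A stabilizer code on the qubits `Q` with a specified (possibly redundant) generating set:
the generated group is abelian and does not contain `-1`. -/
structure StabilizerCode (Q : Type*) [Fintype Q] where
  generators : Set (PauliGroup Q)
  commute : ∀ P ∈ generators, ∀ P' ∈ generators, P * P' = P' * P
  neg_one_notMem : PauliGroup.scalar 2 ∉ Subgroup.closure generators

namespace StabilizerCode

variable {Q : Type*} [Fintype Q]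

/-- The stabilizer group. -/
def stabilizer (C : StabilizerCode Q) : Subgroup (PauliGroup Q) :=
  Subgroup.closure C.generators

/-- The code space: the common `+1` eigenspace of the stabilizer group. -/
noncomputable def codeSpace [DecidableEq Q] (C : StabilizerCode Q) :
    Submodule ℂ ((Q → Fin 2) → ℂ) :=
  ⨅ P ∈ C.stabilizer, Module.End.eigenspace (Matrix.toLin' P.toMatrix) 1

/-- The nontrivial logical Pauli operators: Pauli operators that commute with every generator
and that are not, up to a phase, in the stabilizer group. -/
def nontrivialLogicals (C : StabilizerCode Q) : Set (PauliGroup Q) :=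
  {P | (∀ S ∈ C.generators, S * P = P * S) ∧
    ∀ a : ZMod 4, PauliGroup.scalar a * P ∉ C.stabilizer}

/-- `C` is an `⟦n, k, d⟧` code with `n = |Q|`: the code space has dimension `2 ^ k`, and the
minimum weight of a nontrivial logical Pauli operator exists and equals `d`. -/
def HasParameters [DecidableEq Q] (C : StabilizerCode Q) (k d : ℕ) : Prop :=
  Module.finrank ℂ C.codeSpace = 2 ^ k ∧
    IsLeast (PauliGroup.weight '' C.nontrivialLogicals) d

/-- The connectivity graph: two distinct qubits are adjacent iff some generator contains both
in its support. -/
def connectivityGraph (C : StabilizerCode Q) : SimpleGraph Q where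
  Adj u v := u ≠ v ∧ ∃ S ∈ C.generators, u ∈ S.support ∧ v ∈ S.support
  symm := ⟨fun _ _ h => ⟨h.1.symm, h.2.imp fun _ hS => ⟨hS.1, hS.2.2, hS.2.1⟩⟩⟩
  loopless := ⟨fun _ h => h.1 rfl⟩

end StabilizerCode

/-! Metric notions for families of connected graphs with the shortest-path distance. -/

/-- The closed ball of real radius `r` around `v` in a connected graph. -/
def graphBall {V : Type*} (G : SimpleGraph V) (v : V) (r : ℝ) : Set V :=
  {u | (G.dist v u : ℝ) ≤ r}

/-- The sphere of radius `R` around `v` in a connected graph. -/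
def graphSphere {V : Type*} (G : SimpleGraph V) (v : V) (R : ℕ) : Set V :=
  {u | G.dist v u = R}

/-- The uniform covering condition with exponent `s`: there is a constant `c`, common to the whole
family, such that each ball of radius `R` is covered by at most `c (R / r) ^ s` balls of radius
`r`, for all `0 < r < R`. -/
def CoveringCondition {I : Type*} {V : I → Type*} (G : ∀ i, SimpleGraph (V i)) (s : ℝ) : Prop :=
  ∃ c : ℝ, 0 < c ∧ ∀ (i : I) (v : V i) (r R : ℝ), 0 < r → r < R →
    ∃ F : Finset (V i), (F.card : ℝ) ≤ c * (R / r) ^ s ∧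
      graphBall (G i) v R ⊆ ⋃ u ∈ F, graphBall (G i) u r

/-- The Assouad dimension of a family of connected graphs, with value `⊤` if the covering
condition holds for no exponent. -/
noncomputable def assouadDim {I : Type*} {V : I → Type*} (G : ∀ i, SimpleGraph (V i)) : EReal :=
  sInf ((fun s : ℝ => (s : EReal)) '' {s | CoveringCondition G s})

/-- Strengthened Ahlfors `β`-regularity up to the scales `scale i`, with constants `vLow`, `vHigh`
common to the whole family.  Distances in a graph are integers, so the radii are integers. -/
def StrengthenedAhlforsRegular {I : Type*} {V : I → Type*} (G : ∀ i, SimpleGraph (V i))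
    (β vLow vHigh : ℝ) (scale : I → ℝ) : Prop :=
  ∀ (i : I) (v : V i) (R : ℕ), 1 ≤ R → (R : ℝ) ≤ scale i →
    vLow * (R : ℝ) ^ (β - 1) ≤ ((graphSphere (G i) v R).ncard : ℝ) ∧
      ((graphSphere (G i) v R).ncard : ℝ) ≤ max (vHigh * (R : ℝ) ^ (β - 1)) 1

/-!
The argument is the one of Bravyi, Poulin and Terhal, with a random decomposition by spheres in
place of a tiling of a lattice.

If the qubits are covered by two correctable regions `A`, `B` and a remainder, then `k` is at most
the size of the remainder (`StabilizerCode.HasParameters.le_ncard_compl`).  This is linear algebra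
over `ZMod 2`: modulo phase, the stabilizer group is an isotropic subspace of dimension `n - k` of a
symplectic space, and the cleaning lemma is the statement that taking orthogonal complements twice
does nothing.  A region is correctable if it has fewer than `d` qubits, if it is a union of mutually
non-adjacent correctable regions, or if it arises from a correctable region by adding a correctable
set containing the external boundary; in particular a ball is correctable as long as its concentric
spheres have fewer than `d` points.

Regularity yields such balls at a scale `ρ` of the order of `(d / vHigh) ^ (1 / (β - 1))`.  Take a
`4 ρ`-net and around each of its points a sphere with a radius in `[4 ρ, 8 ρ)`.  The qubits on no
sphere form cells, each inside one ball; the qubits on one sphere form walls with fewer than `d`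
qubits; the remainder consists of qubits on or next to two spheres
(`StabilizerCode.HasParameters.le_ncard_sphereOverlap`).  Comparing volumes, a qubit is near at most
`2 * 10 ^ β * vHigh / vLow` points of the net, and for independent uniform radii it is on one given
sphere and next to another with probability at most `3 / (4 ρ) ^ 2`.  So for some choice of radii
the remainder has at most `n` qubits times a constant over `ρ ^ 2`, which is the bound.

The Assouad dimension is used only to see that `1 ≤ vHigh`
(`StrengthenedAhlforsRegular.one_le_vHigh`): with `vHigh < 1` the maximum in the definition of
regularity makes each sphere of radius one a point, which leaves graphs with at most two
vertices, and such families have dimension at most zero.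
-/

/-! ### Pauli operators modulo phase -/

/-- The Pauli operators modulo phase on the qubits `Q`: the exponents of `X` and `Z` on each
qubit. -/
abbrev PauliVector (Q : Type*) : Type _ := Q → ZMod 2 × ZMod 2

/-- The exponent vector of a Pauli operator, i.e. its class modulo phase. -/
def PauliGroup.toVector {Q : Type*} (P : PauliGroup Q) : PauliVector Q := fun q => (P.x q, P.z q)

theorem PauliGroup.exists_toVector_eq {Q : Type*} (v : PauliVector Q) :
    ∃ P : PauliGroup Q, P.toVector = v := ⟨⟨0, fun q => (v q).1, fun q => (v q).2⟩, rfl⟩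

section Symplectic

variable {Q : Type*} [Fintype Q]

open PauliGroup

/-- The symplectic form on Pauli operators modulo phase; it vanishes exactly on the pairs of
commuting operators. -/
def symplecticForm (Q : Type*) [Fintype Q] : LinearMap.BilinForm (ZMod 2) (PauliVector Q) :=
  LinearMap.mk₂ (ZMod 2) (fun v w => ∑ q, ((v q).1 * (w q).2 + (v q).2 * (w q).1))
    (fun v v' w => by
      rw [← Finset.sum_add_distrib]
      exact Finset.sum_congr rfl fun q _ => by
        simp only [Pi.add_apply, Prod.fst_add, Prod.snd_add]; ring)
    (fun c v w => by
      rw [Finset.smul_sum]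
      exact Finset.sum_congr rfl fun q _ => by
        simp only [Pi.smul_apply, Prod.smul_fst, Prod.smul_snd, smul_eq_mul]; ring)
    (fun v w w' => by
      rw [← Finset.sum_add_distrib]
      exact Finset.sum_congr rfl fun q _ => by
        simp only [Pi.add_apply, Prod.fst_add, Prod.snd_add]; ring)
    (fun c v w => by
      rw [Finset.smul_sum]
      exact Finset.sum_congr rfl fun q _ => by
        simp only [Pi.smul_apply, Prod.smul_fst, Prod.smul_snd, smul_eq_mul]; ring)

theorem symplecticForm_apply (v w : PauliVector Q) :
    symplecticForm Q v w = ∑ q, ((v q).1 * (w q).2 + (v q).2 * (w q).1) := rfl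

theorem symplecticForm_comm (v w : PauliVector Q) :
    symplecticForm Q v w = symplecticForm Q w v := by
  rw [symplecticForm_apply, symplecticForm_apply]
  exact Finset.sum_congr rfl fun q _ => by ring

theorem symplecticForm_isRefl : (symplecticForm Q).IsRefl := fun v w h => by
  rw [symplecticForm_comm]; exact h

theorem symplecticForm_nondegenerate : (symplecticForm Q).Nondegenerate := by
  classical
  have key : (symplecticForm Q).SeparatingLeft := by
    intro v hv
    funext q
    have h1 := hv (Pi.single q (1, 0))
    have h2 := hv (Pi.single q (0, 1))
    rw [symplecticForm_apply, Finset.sum_eq_single q] at h1 h2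
    · ext <;> simp_all
    all_goals simp +contextual
  refine ⟨key, fun v hv => key v fun w => ?_⟩
  rw [symplecticForm_comm]; exact hv w

theorem PauliGroup.commute_iff_symplecticForm (P P' : PauliGroup Q) :
    P * P' = P' * P ↔ symplecticForm Q P.toVector P'.toVector = 0 := by
  have hsum : ∀ f : Q → ZMod 2, ∑ q, signExp (f q) = signExp (∑ q, f q) := fun f =>
    (map_sum (⟨⟨signExp, signExp_zero⟩, signExp_add⟩ : ZMod 2 →+ ZMod 4) f Finset.univ).symm
  have hinj : Function.Injective signExp := by decide
  have hchar : ∀ a b : ZMod 2, a = b ↔ b + a = 0 := by decide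
  have h1 : P * P' = P' * P ↔ ∑ q, P.z q * P'.x q = ∑ q, P'.z q * P.x q := by
    rw [PauliGroup.ext_iff]
    simp only [mul_phase, mul_x, mul_z, hsum, add_comm P'.phase, add_comm P'.x, add_comm P'.z,
      and_true, add_right_inj, hinj.eq_iff]
  rw [h1, hchar, ← Finset.sum_add_distrib, symplecticForm_apply]
  simp only [toVector, mul_comm]

/-- Two Pauli operators with the same exponents differ by a phase. -/
theorem PauliGroup.exists_scalar_mul_eq {P P' : PauliGroup Q} (h : P.toVector = P'.toVector) :
    ∃ a, scalar a * P = P' := by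
  refine ⟨P'.phase - P.phase, ?_⟩
  have hx : P.x = P'.x := funext fun q => congrArg Prod.fst (congrFun h q)
  have hz : P.z = P'.z := funext fun q => congrArg Prod.snd (congrFun h q)
  ext
  · simp [scalar, signExp_zero]
  · simp [scalar, hx]
  · simp [scalar, hz]

theorem PauliGroup.mem_support_iff (P : PauliGroup Q) (q : Q) :
    q ∈ P.support ↔ P.toVector q ≠ 0 := by
  simp [support, toVector, Prod.ext_iff, imp_iff_not_or]

/-! ### The dimension of the code space -/

/-- Non-scalar Pauli operators are traceless. -/
theorem PauliGroup.trace_toMatrix_eq_zero [DecidableEq Q] {P : PauliGroup Q}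
    (h : P.toVector ≠ 0) : P.toMatrix.trace = 0 := by
  obtain ⟨q, hq⟩ := Function.ne_iff.1 h
  have hfac : ∀ a b : ZMod 2, (a, b) ≠ 0 → ∑ c, pauliFactor a b c c = 0 := by
    have h2 : (1 : ZMod 2).val = 1 := rfl
    have key : ∀ a : ZMod 2, a = 0 ∨ a = 1 := by decide
    intro a b hab
    rcases key a with rfl | rfl <;> rcases key b with rfl | rfl
    · exact absurd rfl hab
    all_goals simp [pauliFactor, Fin.sum_univ_two, h2]
  simp only [Matrix.trace, toMatrix, Matrix.diag_apply, Matrix.of_apply]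
  rw [← Finset.mul_sum, ← Fintype.piFinset_univ,
    ← Finset.prod_univ_sum (fun _ => Finset.univ) fun q c => pauliFactor (P.x q) (P.z q) c c,
    Finset.prod_eq_zero (Finset.mem_univ q) (hfac _ _ hq), mul_zero]

theorem PauliGroup.toMatrix_one [DecidableEq Q] : (1 : PauliGroup Q).toMatrix = 1 := by
  ext a b
  simp only [toMatrix, pauliFactor, one_phase, one_x, one_z, Pi.zero_apply, ZMod.val_zero, pow_zero,
    mul_one, Matrix.of_apply, one_mul, Matrix.one_apply, Finset.prod_ite_zero, funext_iff]
  simp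

/-- The Pauli group acting on the Hilbert space of the qubits. -/
noncomputable def PauliGroup.representation (Q : Type*) [Fintype Q] [DecidableEq Q] :
    Representation ℂ (PauliGroup Q) ((Q → Fin 2) → ℂ) where
  toFun P := Matrix.toLin' P.toMatrix
  map_one' := by rw [toMatrix_one, Matrix.toLin'_one]; rfl
  map_mul' P P' := by rw [toMatrix_mul, Matrix.toLin'_mul]; rfl

namespace StabilizerCode

variable (C : StabilizerCode Q)

/-- The stabilizer group modulo phase. -/
def stabilizerSpace : Submodule (ZMod 2) (PauliVector Q) :=
  Submodule.span (ZMod 2) (toVector '' C.generators)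

theorem mem_stabilizerSpace_iff {v : PauliVector Q} :
    v ∈ C.stabilizerSpace ↔ ∃ P ∈ C.stabilizer, P.toVector = v := by
  constructor
  · intro hv
    induction hv using Submodule.span_induction with
    | mem x hx =>
      obtain ⟨P, hP, rfl⟩ := hx
      exact ⟨P, Subgroup.subset_closure hP, rfl⟩
    | zero => exact ⟨1, one_mem _, rfl⟩
    | add x y _ _ hx hy =>
      obtain ⟨P, hP, rfl⟩ := hx
      obtain ⟨P', hP', rfl⟩ := hy
      exact ⟨P * P', mul_mem hP hP', rfl⟩
    | smul a x _ hx =>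
      have key : ∀ a : ZMod 2, a = 0 ∨ a = 1 := by decide
      rcases key a with rfl | rfl
      · exact ⟨1, one_mem _, by rw [zero_smul]; rfl⟩
      · rwa [one_smul]
  · rintro ⟨P, hP, rfl⟩
    induction hP using Subgroup.closure_induction with
    | mem x hx => exact Submodule.subset_span ⟨x, hx, rfl⟩
    | one => exact zero_mem _
    | mul x y _ _ hx hy => exact add_mem hx hy
    | inv x _ hx => exact hx

theorem scalar_mem_stabilizer {a : ZMod 4} (h : scalar a ∈ C.stabilizer) : a = 0 := by
  have key : ∀ a : ZMod 4, a = 0 ∨ a = 2 ∨ a + a = 2 := by decide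
  have hmul : (scalar a * scalar a : PauliGroup Q) = scalar (a + a) := by
    ext <;> simp [scalar, signExp_zero]
  rcases key a with h0 | h2 | h2
  · exact h0
  · exact absurd (h2 ▸ h) C.neg_one_notMem
  · exact absurd (h2 ▸ hmul ▸ mul_mem h h) C.neg_one_notMem

theorem toVector_injOn_stabilizer : Set.InjOn toVector (C.stabilizer : Set (PauliGroup Q)) := by
  intro P hP P' hP' h
  obtain ⟨a, ha⟩ := exists_scalar_mul_eq h
  have hmem : scalar a ∈ C.stabilizer := by
    rw [eq_mul_inv_of_mul_eq ha]
    exact mul_mem hP' (inv_mem hP)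
  rw [← ha, C.scalar_mem_stabilizer hmem]
  exact (one_mul P).symm

theorem card_stabilizer : Nat.card C.stabilizer = Nat.card C.stabilizerSpace :=
  Nat.card_eq_of_bijective
    (fun P => ⟨toVector P.1, C.mem_stabilizerSpace_iff.2 ⟨P.1, P.2, rfl⟩⟩)
    ⟨fun P P' h => Subtype.ext (C.toVector_injOn_stabilizer P.2 P'.2 (congrArg Subtype.val h)),
      fun ⟨v, hv⟩ => by
        obtain ⟨P, hP, rfl⟩ := C.mem_stabilizerSpace_iff.1 hv
        exact ⟨⟨P, hP⟩, rfl⟩⟩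

/-- The averaged stabilizer is a projection onto the code space, and only the identity
contributes to its trace. -/
theorem card_stabilizer_mul_finrank_codeSpace [DecidableEq Q] :
    Nat.card C.stabilizer * Module.finrank ℂ C.codeSpace = 2 ^ Fintype.card Q := by
  classical
  have hfin : Finite C.stabilizer := (Nat.finite_of_card_ne_zero
    (by rw [card_stabilizer]; exact Nat.card_pos.ne'))
  have := Fintype.ofFinite C.stabilizer
  have hcard : (Fintype.card C.stabilizer : ℂ) ≠ 0 := by exact_mod_cast Fintype.card_ne_zero
  have : Invertible (Fintype.card C.stabilizer : ℂ) := invertibleOfNonzero hcard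
  let ρ : Representation ℂ C.stabilizer ((Q → Fin 2) → ℂ) :=
    (representation Q).comp C.stabilizer.subtype
  have hinv : ρ.invariants = C.codeSpace := by
    ext v
    simp only [Representation.mem_invariants, codeSpace, Submodule.mem_iInf,
      Module.End.mem_eigenspace_iff, one_smul, Subtype.forall]
    rfl
  have htr := (Representation.isProj_averageMap ρ).trace
  rw [hinv, Representation.averageMap, GroupAlgebra.average, map_smul, map_sum, map_smul,
    map_sum, Finset.sum_eq_single 1] at htr
  · have h1 : Representation.asAlgebraHom ρ (MonoidAlgebra.of ℂ C.stabilizer 1) = 1 := by simp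
    rw [h1, LinearMap.trace_one, Module.finrank_pi] at htr
    simp only [invOf_eq_inv, smul_eq_mul] at htr
    rw [inv_mul_eq_iff_eq_mul₀ hcard] at htr
    rw [Nat.card_eq_fintype_card]
    apply Nat.cast_injective (R := ℂ)
    push_cast
    rw [← htr]
    simp
  · intro P _ hP
    simp only [MonoidAlgebra.of_apply, Representation.asAlgebraHom_single, one_smul]
    change LinearMap.trace ℂ _ (Matrix.toLin' P.1.toMatrix) = 0
    rw [Matrix.trace_toLin'_eq]
    refine trace_toMatrix_eq_zero fun h => hP (Subtype.ext ?_)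
    exact C.toVector_injOn_stabilizer P.2 (one_mem _) h
  · simp

theorem finrank_stabilizerSpace_add [DecidableEq Q] {k : ℕ}
    (hk : Module.finrank ℂ C.codeSpace = 2 ^ k) :
    Module.finrank (ZMod 2) C.stabilizerSpace + k = Fintype.card Q := by
  have h := C.card_stabilizer_mul_finrank_codeSpace
  rw [hk, C.card_stabilizer, Module.natCard_eq_pow_finrank (K := ZMod 2), Nat.card_zmod,
    ← pow_add] at h
  exact Nat.pow_right_injective le_rfl h

end StabilizerCode

end Symplectic

/-! ### Correctable regions -/

/-- The Pauli operators modulo phase that are supported on the region `A`. -/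
def supportedOn {Q : Type*} (A : Set Q) : Submodule (ZMod 2) (PauliVector Q) where
  carrier := {v | ∀ q ∉ A, v q = 0}
  add_mem' hv hw q hq := by simp [hv q hq, hw q hq]
  zero_mem' _ _ := rfl
  smul_mem' c v hv q hq := by simp [hv q hq]

namespace StabilizerCode

open PauliGroup

variable {Q : Type*} [Fintype Q] (C : StabilizerCode Q)

/-- The logical operators modulo phase: the operators commuting with the stabilizer. -/
def logicalSpace : Submodule (ZMod 2) (PauliVector Q) :=
  (symplecticForm Q).orthogonal C.stabilizerSpace

/-- A region is correctable if every logical operator supported on it is trivial. -/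
def Correctable (A : Set Q) : Prop :=
  ∀ v ∈ C.logicalSpace, v ∈ supportedOn A → v ∈ C.stabilizerSpace

variable {C}

theorem mem_logicalSpace_iff {v : PauliVector Q} :
    v ∈ C.logicalSpace ↔ ∀ P ∈ C.generators, symplecticForm Q P.toVector v = 0 := by
  refine ⟨fun h P hP => h _ (Submodule.subset_span ⟨P, hP, rfl⟩), fun h w hw => ?_⟩
  change symplecticForm Q w v = 0
  induction hw using Submodule.span_induction with
  | mem x hx => obtain ⟨P, hP, rfl⟩ := hx; exact h P hP
  | zero => simp
  | add x y _ _ hx hy => simp [hx, hy]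
  | smul a x _ hx => simp [hx]

theorem stabilizerSpace_le_logicalSpace : C.stabilizerSpace ≤ C.logicalSpace := by
  refine Submodule.span_le.2 ?_
  rintro _ ⟨P, hP, rfl⟩
  exact mem_logicalSpace_iff.2 fun P' hP' =>
    (commute_iff_symplecticForm P' P).1 (C.commute P' hP' P hP)

theorem Correctable.mono {A B : Set Q} (hB : C.Correctable B) (h : A ⊆ B) : C.Correctable A :=
  fun v hv hA => hB v hv fun q hq => hA q fun hqA => hq (h hqA)

theorem HasParameters.correctable_of_ncard_lt [DecidableEq Q] {k d : ℕ}
    (hC : C.HasParameters k d) {A : Set Q} (hA : A.ncard < d) : C.Correctable A := by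
  intro v hv hvA
  obtain ⟨P, rfl⟩ := exists_toVector_eq v
  by_contra hP
  have hlog : P ∈ C.nontrivialLogicals := by
    refine ⟨fun S hS => (commute_iff_symplecticForm S P).2 (mem_logicalSpace_iff.1 hv S hS),
      fun a ha => hP (C.mem_stabilizerSpace_iff.2 ⟨_, ha, ?_⟩)⟩
    funext q
    simp [toVector, scalar]
  have hle : d ≤ P.weight := hC.2.2 ⟨P, hlog, rfl⟩
  have hsub : (P.support : Set Q) ⊆ A := fun q hq => by
    by_contra hqA
    exact (P.mem_support_iff q).1 hq (hvA q hqA)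
  have := Set.ncard_le_ncard hsub A.toFinite
  rw [Set.ncard_coe_finset] at this
  exact absurd (hle.trans this) hA.not_ge

theorem HasParameters.pos [DecidableEq Q] {k d : ℕ} (hC : C.HasParameters k d) : 0 < d := by
  obtain ⟨P, hP, rfl⟩ := hC.2.1
  refine Finset.card_pos.2 (Finset.nonempty_iff_ne_empty.2 fun h => ?_)
  have h0 : (1 : PauliGroup Q).toVector = P.toVector := funext fun q => by
    by_contra hq
    have : q ∈ P.support := (P.mem_support_iff q).2 (Ne.symm hq)
    rw [h] at this
    exact absurd this (Finset.notMem_empty q)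
  obtain ⟨a, ha⟩ := exists_scalar_mul_eq h0.symm
  exact hP.2 a (ha ▸ one_mem _)

/-- The cleaning lemma: every logical operator can be multiplied by a stabilizer so that it acts
trivially on a given correctable region. -/
theorem Correctable.logicalSpace_le {A : Set Q} (hA : C.Correctable A) :
    C.logicalSpace ≤ C.stabilizerSpace ⊔ supportedOn Aᶜ := by
  classical
  rw [← LinearMap.BilinForm.orthogonal_orthogonal symplecticForm_nondegenerate
    symplecticForm_isRefl (C.stabilizerSpace ⊔ supportedOn Aᶜ)]
  refine LinearMap.BilinForm.orthogonal_le fun v hv => ?_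
  refine hA v (fun w hw => hv w (Submodule.mem_sup_left hw)) fun q hq => ?_
  have hsingle : ∀ e, symplecticForm Q (Pi.single q e) v = 0 := fun e =>
    hv _ (Submodule.mem_sup_right fun p hp => by
      rw [Pi.single_eq_of_ne]
      rintro rfl
      exact hp hq)
  have h1 := hsingle (1, 0)
  have h2 := hsingle (0, 1)
  rw [symplecticForm_apply, Finset.sum_eq_single q] at h1 h2
  · ext <;> simp_all
  all_goals simp +contextual

/-- A correctable region can be enlarged by any correctable region that contains its external
boundary: cleaning a logical operator needs only the generators meeting the region, and these do
not reach beyond the boundary. -/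
theorem Correctable.union_of_boundary {A B : Set Q} (hA : C.Correctable A)
    (hB : C.Correctable B)
    (hAB : ∀ u ∈ A, ∀ v, C.connectivityGraph.Adj u v → v ∈ A ∪ B) : C.Correctable (A ∪ B) := by
  intro v hv hvAB
  obtain ⟨s, hs, t, ht, hst⟩ := Submodule.mem_sup.1 (hA.logicalSpace_le hv)
  let G₁ : Set (PauliGroup Q) := {P ∈ C.generators | ∃ q ∈ A, q ∈ P.support}
  let G₂ : Set (PauliGroup Q) := {P ∈ C.generators | ∀ q ∈ A, q ∉ P.support}
  have hG : C.generators = G₁ ∪ G₂ := by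
    ext P
    simp only [G₁, G₂, Set.mem_union, Set.mem_ofPred_eq, ← and_or_left]
    have : (∃ q ∈ A, q ∈ P.support) ∨ ∀ q ∈ A, q ∉ P.support := by
      by_contra! h
      obtain ⟨q, hq, hqP⟩ := h.2
      exact h.1 q hq hqP
    simp [this]
  have h₁ : Submodule.span (ZMod 2) (toVector '' G₁) ≤ C.stabilizerSpace ⊓ supportedOn (A ∪ B) := by
    refine Submodule.span_le.2 ?_
    rintro _ ⟨P, ⟨hP, q, hqA, hqP⟩, rfl⟩
    refine ⟨Submodule.subset_span ⟨P, hP, rfl⟩, fun p hp => ?_⟩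
    by_contra hne
    refine hp (hAB q hqA p ⟨?_, P, hP, hqP, (P.mem_support_iff p).2 hne⟩)
    rintro rfl
    exact hp (Or.inl hqA)
  have h₂ : Submodule.span (ZMod 2) (toVector '' G₂) ≤ supportedOn Aᶜ := by
    refine Submodule.span_le.2 ?_
    rintro _ ⟨P, ⟨hP, hPA⟩, rfl⟩ p hp
    by_contra hne
    exact hPA p (not_not.1 hp) ((P.mem_support_iff p).2 hne)
  rw [stabilizerSpace, hG, Set.image_union, Submodule.span_union] at hs
  obtain ⟨s₁, hs₁, s₂, hs₂, rfl⟩ := Submodule.mem_sup.1 hs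
  obtain ⟨hs₁C, hs₁AB⟩ := h₁ hs₁
  have hmem : v - s₁ ∈ C.stabilizerSpace := by
    refine hB _ (sub_mem hv (stabilizerSpace_le_logicalSpace hs₁C)) fun q hq => ?_
    by_cases hqA : q ∈ A
    · have : v - s₁ = s₂ + t := by rw [← hst]; abel
      rw [this]
      exact add_mem (h₂ hs₂) ht q (not_not.2 hqA)
    · exact sub_mem hvAB hs₁AB q fun h => h.elim hqA hq
  have := add_mem hmem hs₁C
  rwa [sub_add_cancel] at this

/-- A region is correctable if it splits into correctable parts with no edges between different
parts: every generator meets at most one part, so the restriction of a logical operator to each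
part is again logical. -/
theorem Correctable.of_labelling {ι : Type*} {A : Set Q} (f : Q → ι)
    (hadj : ∀ u ∈ A, ∀ v ∈ A, C.connectivityGraph.Adj u v → f u = f v)
    (hf : ∀ j, C.Correctable (A ∩ f ⁻¹' {j})) : C.Correctable A := by
  classical
  intro v hv hvA
  let part : ι → PauliVector Q := fun j q => if f q = j then v q else 0
  have hsum : v = ∑ j ∈ Finset.univ.image f, part j := by
    funext q
    simp [part]
  have hform : ∀ P j, symplecticForm Q (toVector P) (part j) =
      ∑ q, if f q = j then (P.x q * (v q).2 + P.z q * (v q).1) else 0 := fun P j => by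
    rw [symplecticForm_apply]
    refine Finset.sum_congr rfl fun q _ => ?_
    by_cases h : f q = j <;> simp [part, h, toVector]
  rw [hsum]
  refine sum_mem fun j _ => hf j _ (mem_logicalSpace_iff.2 fun P hP => ?_) fun q hq => ?_
  · rw [hform]
    -- Either no qubit of part `j` contributes, or all the contributing qubits lie in part `j`.
    by_cases hj : ∃ q ∈ P.support, q ∈ A ∧ f q = j
    · obtain ⟨p, hpP, hpA, hpj⟩ := hj
      refine Eq.trans ?_ (mem_logicalSpace_iff.1 hv P hP)
      rw [symplecticForm_apply]
      refine Finset.sum_congr rfl fun q _ => ?_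
      by_cases hqj : f q = j
      · rw [if_pos hqj]; rfl
      rw [if_neg hqj]
      by_cases hqA : q ∈ A
      · have hqP : q ∉ P.support := fun hqP => by
          refine hqj ((hadj p hpA q hqA ⟨?_, P, hP, hpP, hqP⟩).symm.trans hpj)
          rintro rfl
          exact hqj hpj
        rw [mem_support_iff, not_not] at hqP
        simp [hqP]
      · simp [hvA q hqA]
    · push Not at hj
      refine Finset.sum_eq_zero fun q _ => ?_
      by_cases hqj : f q = j
      · rw [if_pos hqj]
        by_cases hqA : q ∈ A
        · have hqP : q ∉ P.support := fun hqP => hj q hqP hqA hqj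
          rw [mem_support_iff, not_not] at hqP
          obtain ⟨hx, hz⟩ := Prod.ext_iff.1 hqP
          simp only [toVector, Prod.fst_zero, Prod.snd_zero] at hx hz
          simp [hx, hz]
        · simp [hvA q hqA]
      · rw [if_neg hqj]
  · by_cases hqj : f q = j
    · have : q ∉ A := fun hqA => hq ⟨hqA, hqj⟩
      simp [part, hvA q this]
    · simp [part, hqj]

/-- If the regions `A` and `B` are correctable, the qubits outside `A ∪ B` bound the number of
logical qubits: all `2 k` independent logical operators can be cleaned out of `A`, those which then
live on `B` alone are trivial, and a Pauli operator has two exponents per remaining qubit. -/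
theorem HasParameters.le_ncard_compl [DecidableEq Q] {k d : ℕ} (hC : C.HasParameters k d)
    {A B : Set Q} (hA : C.Correctable A) (hB : C.Correctable B) : k ≤ (A ∪ B)ᶜ.ncard := by
  classical
  set W := C.stabilizerSpace
  set L := C.logicalSpace
  have hWL : W ≤ L := stabilizerSpace_le_logicalSpace
  have hW : Module.finrank (ZMod 2) W + k = Fintype.card Q :=
    C.finrank_stabilizerSpace_add hC.1
  have hV : Module.finrank (ZMod 2) (PauliVector Q) = Fintype.card Q * 2 := by
    simp [PauliVector, Module.finrank_pi_fintype, Module.finrank_prod]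
  have hL : Module.finrank (ZMod 2) L = Fintype.card Q * 2 - Module.finrank (ZMod 2) W := by
    rw [← hV]
    exact LinearMap.BilinForm.finrank_orthogonal symplecticForm_nondegenerate W
  set T := L ⊓ supportedOn Aᶜ
  have hLT : W ⊔ T = L := by
    refine le_antisymm (sup_le hWL inf_le_left) fun v hv => ?_
    obtain ⟨s, hs, t, ht, rfl⟩ := Submodule.mem_sup.1 (hA.logicalSpace_le hv)
    refine Submodule.add_mem_sup hs ⟨?_, ht⟩
    have := sub_mem hv (hWL hs)
    rwa [add_sub_cancel_left] at this
  have hdim := Submodule.finrank_sup_add_finrank_inf_eq W T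
  rw [hLT] at hdim
  -- Restriction of the cleaned logical operators to the complement of `A ∪ B`.
  let res : T →ₗ[ZMod 2] ((A ∪ B)ᶜ : Set Q) → ZMod 2 × ZMod 2 :=
    LinearMap.funLeft (ZMod 2) (ZMod 2 × ZMod 2) Subtype.val ∘ₗ T.subtype
  have hrn := LinearMap.finrank_range_add_finrank_ker res
  have hrange : Module.finrank (ZMod 2) (LinearMap.range res) ≤ (A ∪ B)ᶜ.ncard * 2 := by
    refine (Submodule.finrank_le _).trans (le_of_eq ?_)
    rw [Module.finrank_pi_fintype, ← Nat.card_coe_set_eq, Nat.card_eq_fintype_card]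
    simp only [Module.finrank_prod, Module.finrank_self, Finset.sum_const, Finset.card_univ,
      smul_eq_mul]
  have hker : Module.finrank (ZMod 2) (LinearMap.ker res) ≤ Module.finrank (ZMod 2) ↥(W ⊓ T) := by
    rw [← Submodule.finrank_map_subtype_eq]
    refine Submodule.finrank_mono ?_
    rintro _ ⟨⟨v, hvT⟩, hv, rfl⟩
    refine ⟨hB v hvT.1 fun q hq => ?_, hvT⟩
    by_cases hqA : q ∈ A
    · exact hvT.2 q (not_not.2 hqA)
    · exact congrFun (LinearMap.mem_ker.1 hv) ⟨q, fun h => h.elim hqA hq⟩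
  omega

end StabilizerCode

/-! ### Random spheres around a net -/

theorem SimpleGraph.Adj.dist_le_add_one {V : Type*} {G : SimpleGraph V} {u v : V}
    (h : G.Adj u v) (x : V) : G.dist x v ≤ G.dist x u + 1 := by
  rcases h.diff_dist_adj (u := x) with h | h | h <;> omega

/-- In a finite graph there is an `R`-net: a set of vertices at mutual distances larger
than `R` such that each vertex is at distance at most `R` from it. -/
theorem SimpleGraph.exists_net {V : Type*} [Fintype V] (G : SimpleGraph V) (R : ℕ) :
    ∃ X : Finset V, (∀ x ∈ X, ∀ y ∈ X, x ≠ y → R < G.dist x y) ∧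
      ∀ u, ∃ x ∈ X, G.dist x u ≤ R := by
  classical
  let sep : Finset (Finset V) :=
    Finset.univ.filter fun X => ∀ x ∈ X, ∀ y ∈ X, x ≠ y → R < G.dist x y
  obtain ⟨X, hX⟩ := sep.exists_maximal ⟨∅, by simp [sep]⟩
  have hsep : ∀ x ∈ X, ∀ y ∈ X, x ≠ y → R < G.dist x y := (Finset.mem_filter.1 hX.prop).2
  refine ⟨X, hsep, fun u => ?_⟩
  by_contra! hu
  have huX : u ∉ X := fun h => by simpa using hu u h
  refine huX (hX.le_of_ge (y := insert u X) (Finset.mem_filter.2 ⟨Finset.mem_univ _, ?_⟩)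
    (Finset.subset_insert u X) (Finset.mem_insert_self u X))
  intro x hx y hy hxy
  rw [Finset.mem_insert] at hx hy
  rcases hx with rfl | hx <;> rcases hy with rfl | hy
  · exact absurd rfl hxy
  · rw [G.dist_comm]; exact hu y hy
  · exact hu x hx
  · exact hsep x hx y hy hxy

/-- The vertices that lie on one of the spheres of radius `r x` around the points `x ∈ X` and at
distance at most one from the radius of another one. -/
def sphereOverlap {V : Type*} (G : SimpleGraph V) (X : Finset V) (r : V → ℕ) : Set V :=
  {u | ∃ i ∈ X, ∃ j ∈ X, i ≠ j ∧ G.dist i u = r i ∧ r j ≤ G.dist j u + 1 ∧ G.dist j u ≤ r j + 1}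

/-- Among the functions with values in `[R, 2R)`, a proportion of at most `3 / R ^ 2` takes a given
value at one point and, up to one, a given value at another point. -/
theorem card_filter_two_values_le {V : Type*} [Fintype V] [DecidableEq V] (R : ℕ) {i j : V}
    (hij : i ≠ j) (a b : ℕ) :
    R ^ 2 * ((Fintype.piFinset fun _ : V => Finset.Ico R (2 * R)).filter
      fun r => a = r i ∧ r j ≤ b + 1 ∧ b ≤ r j + 1).card ≤
      3 * (Fintype.piFinset fun _ : V => Finset.Ico R (2 * R)).card := by
  have hIco : (Finset.Ico R (2 * R)).card = R := by rw [Nat.card_Ico]; omega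
  have hsplit : ∀ f : V → ℕ,
      ∏ q, f q = f i * (f j * ∏ q ∈ (Finset.univ.erase i).erase j, f q) := fun f => by
    rw [Finset.mul_prod_erase _ _ (Finset.mem_erase.2 ⟨hij.symm, Finset.mem_univ j⟩),
      Finset.mul_prod_erase _ _ (Finset.mem_univ i)]
  let c : V → Finset ℕ := fun q =>
    if q = i then {a} else if q = j then Finset.Icc (b - 1) (b + 1) else Finset.Ico R (2 * R)
  have hsub : ((Fintype.piFinset fun _ : V => Finset.Ico R (2 * R)).filter
      fun r => a = r i ∧ r j ≤ b + 1 ∧ b ≤ r j + 1) ⊆ Fintype.piFinset c := by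
    intro r hr
    obtain ⟨hr, h1, h2, h3⟩ := Finset.mem_filter.1 hr
    refine Fintype.mem_piFinset.2 fun q => ?_
    by_cases hqi : q = i
    · subst hqi; simp [c, h1]
    by_cases hqj : q = j
    · subst hqj
      simp only [c, hqi, if_false, if_true, Finset.mem_Icc]
      omega
    · simpa [c, hqi, hqj] using Fintype.mem_piFinset.1 hr q
  have hci : (c i).card = 1 := by simp [c]
  have hcj : (c j).card ≤ 3 := by
    simp only [c, hij.symm, if_false, if_true, Nat.card_Icc]; omega
  have hrest : ∏ q ∈ (Finset.univ.erase i).erase j, (c q).card =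
      ∏ q ∈ (Finset.univ.erase i).erase j, (Finset.Ico R (2 * R)).card :=
    Finset.prod_congr rfl fun q hq => by
      have h1 := (Finset.mem_erase.1 hq).1
      have h2 := (Finset.mem_erase.1 (Finset.mem_erase.1 hq).2).1
      simp [c, h1, h2]
  refine (Nat.mul_le_mul_left _ (Finset.card_le_card hsub)).trans ?_
  rw [Fintype.card_piFinset, Fintype.card_piFinset, hsplit, hsplit, hrest, hci, hIco]
  set m := ∏ q ∈ (Finset.univ.erase i).erase j, R
  calc R ^ 2 * (1 * ((c j).card * m)) ≤ R ^ 2 * (1 * (3 * m)) := by gcongr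
    _ = 3 * (R * (R * m)) := by ring

/-- If each vertex is within distance `2 R` of at most `M` points of `X`, then radii in
`[R, 2 R)` can be chosen such that the overlap of the spheres is a proportion of at most
`3 M ^ 2 / R ^ 2` of the vertices: this bounds the expected proportion for independent uniform
radii. -/
theorem exists_radii_card_sphereOverlap_le {V : Type*} [Fintype V] [DecidableEq V]
    (G : SimpleGraph V) (X : Finset V) {R M : ℕ} (hR : 0 < R)
    (hM : ∀ u, (X.filter fun x => G.dist x u ≤ 2 * R).card ≤ M) :
    ∃ r : V → ℕ, (∀ x, R ≤ r x ∧ r x < 2 * R) ∧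
      R ^ 2 * (sphereOverlap G X r).ncard ≤ 3 * M ^ 2 * Fintype.card V := by
  classical
  let Ω := Fintype.piFinset fun _ : V => Finset.Ico R (2 * R)
  let near : V → Finset V := fun u => X.filter fun x => G.dist x u ≤ 2 * R
  have hΩ : Ω.Nonempty :=
    ⟨fun _ => R, Fintype.mem_piFinset.2 fun _ => Finset.mem_Ico.2 ⟨le_rfl, by omega⟩⟩
  let hit : V → V × V → (V → ℕ) → Prop := fun u p r =>
    G.dist p.1 u = r p.1 ∧ r p.2 ≤ G.dist p.2 u + 1 ∧ G.dist p.2 u ≤ r p.2 + 1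
  have hbound : ∀ r ∈ Ω, (sphereOverlap G X r).ncard ≤
      ∑ u, ∑ p ∈ (near u).offDiag, if hit u p r then 1 else 0 := by
    intro r hr
    have hr' : ∀ x, r x < 2 * R := fun x => (Finset.mem_Ico.1 (Fintype.mem_piFinset.1 hr x)).2
    have hcard : (sphereOverlap G X r).ncard =
        ∑ u, if u ∈ sphereOverlap G X r then 1 else 0 := by
      rw [← Finset.card_filter, ← Set.ncard_coe_finset]
      simp
    rw [hcard]
    refine Finset.sum_le_sum fun u _ => ?_
    split_ifs with hu
    · obtain ⟨i, hi, j, hj, hij, h1, h2, h3⟩ := hu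
      have hmem : (i, j) ∈ (near u).offDiag := by
        have := hr' i
        have := hr' j
        refine Finset.mem_offDiag.2
          ⟨Finset.mem_filter.2 ⟨hi, ?_⟩, Finset.mem_filter.2 ⟨hj, ?_⟩, hij⟩
        · change G.dist i u ≤ 2 * R; omega
        · change G.dist j u ≤ 2 * R; omega
      refine le_trans ?_ (Finset.single_le_sum (fun _ _ => Nat.zero_le _) hmem)
      rw [if_pos ⟨h1, h2, h3⟩]
    · exact Nat.zero_le _
  obtain ⟨r, hr, hle⟩ := Finset.exists_le_of_sum_le hΩ
    (f := fun r => R ^ 2 * (sphereOverlap G X r).ncard)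
    (g := fun _ => 3 * M ^ 2 * Fintype.card V) (by
      calc ∑ r ∈ Ω, R ^ 2 * (sphereOverlap G X r).ncard
          ≤ ∑ r ∈ Ω, R ^ 2 * ∑ u, ∑ p ∈ (near u).offDiag, if hit u p r then 1 else 0 :=
            Finset.sum_le_sum fun r hr => Nat.mul_le_mul_left _ (hbound r hr)
        _ = ∑ u, ∑ p ∈ (near u).offDiag, R ^ 2 * (Ω.filter fun r => hit u p r).card := by
            simp only [Finset.card_filter, Finset.mul_sum]
            rw [Finset.sum_comm]
            exact Finset.sum_congr rfl fun u _ => Finset.sum_comm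
        _ ≤ ∑ u, ∑ p ∈ (near u).offDiag, 3 * Ω.card :=
            Finset.sum_le_sum fun u _ => Finset.sum_le_sum fun p hp =>
              card_filter_two_values_le R (Finset.mem_offDiag.1 hp).2.2 _ _
        _ ≤ ∑ _u : V, M ^ 2 * (3 * Ω.card) := by
            refine Finset.sum_le_sum fun u _ => ?_
            rw [Finset.sum_const, smul_eq_mul]
            refine Nat.mul_le_mul_right _ ?_
            rw [Finset.offDiag_card, pow_two]
            exact (Nat.sub_le _ _).trans (Nat.mul_le_mul (hM u) (hM u))
        _ = ∑ r ∈ Ω, 3 * M ^ 2 * Fintype.card V := by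
            rw [Finset.sum_const, Finset.sum_const, Finset.card_univ, smul_eq_mul, smul_eq_mul]
            ring)
  exact ⟨r, fun x => Finset.mem_Ico.1 (Fintype.mem_piFinset.1 hr x), hle⟩

namespace StabilizerCode

variable {Q : Type*} [Fintype Q] [DecidableEq Q] {C : StabilizerCode Q} {k d : ℕ}

/-- Balls grow sphere by sphere and stay correctable as long as the spheres are smaller than the
distance of the code. -/
theorem HasParameters.correctable_ball (hC : C.HasParameters k d) (x : Q) (m : ℕ)
    (hs : ∀ l ≤ m, (graphSphere C.connectivityGraph x l).ncard < d) :
    C.Correctable {u | C.connectivityGraph.dist x u ≤ m} := by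
  induction m with
  | zero =>
    refine (hC.correctable_of_ncard_lt (hs 0 le_rfl)).mono fun u hu => ?_
    exact Nat.le_zero.1 hu
  | succ m ih =>
    refine ((ih fun l hl => hs l (by omega)).union_of_boundary
      (hC.correctable_of_ncard_lt (hs (m + 1) le_rfl)) fun u hu v huv => ?_).mono fun u hu => ?_
    · have h1 := huv.dist_le_add_one x
      have h2 : C.connectivityGraph.dist x u ≤ m := hu
      rcases Nat.lt_or_ge m (C.connectivityGraph.dist x v) with h | h
      · exact Or.inr (show C.connectivityGraph.dist x v = m + 1 by omega)
      · exact Or.inl h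
    · rcases Nat.lt_or_ge m (C.connectivityGraph.dist x u) with h | h
      · exact Or.inr (le_antisymm hu h)
      · exact Or.inl h

/-- The spheres around the points of a net cut the qubits into pieces: the qubits on no sphere form
correctable cells inside the balls, and the qubits on exactly one sphere, up to the overlap, form
correctable walls.  Neither two cells nor two walls are adjacent, so the overlap bounds `k`. -/
theorem HasParameters.le_ncard_sphereOverlap (hC : C.HasParameters k d) {R : ℕ}
    (X : Finset Q)
    (hnet : ∀ u, ∃ x ∈ X, C.connectivityGraph.dist x u ≤ R) (r : Q → ℕ) (hr : ∀ x, R ≤ r x)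
    (hs : ∀ x, ∀ l ≤ r x, (graphSphere C.connectivityGraph x l).ncard < d) :
    k ≤ (sphereOverlap C.connectivityGraph X r).ncard := by
  classical
  set G := C.connectivityGraph
  let A : Set Q := {u | ∀ x ∈ X, G.dist x u ≠ r x}
  let B : Set Q := {u | u ∉ sphereOverlap G X r ∧ ∃ x ∈ X, G.dist x u = r x}
  have hA : C.Correctable A := by
    refine Correctable.of_labelling (fun u => X.filter fun x => G.dist x u ≤ r x) ?_ ?_
    · intro u hu v hv huv
      refine Finset.filter_congr fun x hx => ?_
      have h1 : G.dist x u ≠ r x := hu x hx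
      have h2 : G.dist x v ≠ r x := hv x hx
      have h3 : G.dist x v ≤ G.dist x u + 1 := huv.dist_le_add_one x
      have h4 : G.dist x u ≤ G.dist x v + 1 := huv.symm.dist_le_add_one x
      omega
    · intro T
      rcases (A ∩ (fun u => X.filter fun x => G.dist x u ≤ r x) ⁻¹' {T}).eq_empty_or_nonempty
        with h | ⟨u, -, hu⟩
      · rw [h]
        exact hC.correctable_of_ncard_lt (by simpa using hC.pos)
      · obtain ⟨x, hx, hxu⟩ := hnet u
        have hxT : x ∈ T := by
          rw [← (show _ = T from hu)]
          exact Finset.mem_filter.2 ⟨hx, hxu.trans (hr x)⟩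
        refine (hC.correctable_ball x (r x) (hs x)).mono ?_
        rintro v ⟨-, rfl⟩
        exact (Finset.mem_filter.1 hxT).2
  have hB : C.Correctable B := by
    refine Correctable.of_labelling (fun u => X.filter fun x => G.dist x u = r x) ?_ ?_
    · have hsub : ∀ u ∈ B, ∀ v ∈ B, G.Adj u v → ∀ x ∈ X, G.dist x u = r x → G.dist x v = r x := by
        intro u hu v hv huv x hx hxu
        obtain ⟨y, hy, hyv⟩ := hv.2
        have h3 := huv.dist_le_add_one y
        have h4 := huv.symm.dist_le_add_one y
        by_cases hxy : x = y
        · rwa [hxy]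
        · exact absurd ⟨x, hx, y, hy, hxy, hxu, by omega, by omega⟩ hu.1
      intro u hu v hv huv
      exact Finset.filter_congr fun x hx => ⟨hsub u hu v hv huv x hx, hsub v hv u hu huv.symm x hx⟩
    · intro T
      rcases (B ∩ (fun u => X.filter fun x => G.dist x u = r x) ⁻¹' {T}).eq_empty_or_nonempty
        with h | ⟨u, hu, hT⟩
      · rw [h]
        exact hC.correctable_of_ncard_lt (by simpa using hC.pos)
      · obtain ⟨x, hx, hxu⟩ := hu.2
        have hxT : x ∈ T := by
          rw [← (show _ = T from hT)]
          exact Finset.mem_filter.2 ⟨hx, hxu⟩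
        refine (hC.correctable_of_ncard_lt (hs x (r x) le_rfl)).mono ?_
        rintro v ⟨-, rfl⟩
        exact (Finset.mem_filter.1 hxT).2
  refine (hC.le_ncard_compl hA hB).trans (Set.ncard_le_ncard (fun u hu => ?_) (Set.toFinite _))
  by_contra hov
  refine hu ?_
  by_cases h : ∃ x ∈ X, G.dist x u = r x
  · exact Or.inr ⟨hov, h⟩
  · exact Or.inl fun x hx hxu => h ⟨x, hx, hxu⟩

end StabilizerCode

/-! ### Volume and packing -/

theorem SimpleGraph.Connected.ncard_graphSphere_zero {V : Type*} {G : SimpleGraph V}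
    (hG : G.Connected) (x : V) :
    (graphSphere G x 0).ncard = 1 := by
  rw [Set.ncard_eq_one]
  refine ⟨x, Set.ext fun u => ?_⟩
  change G.dist x u = 0 ↔ u = x
  rw [hG.dist_eq_zero_iff, eq_comm]

section Volume

variable {V : Type*} [Fintype V] {G : SimpleGraph V} {β c : ℝ}

theorem ncard_graphSphere (G : SimpleGraph V) (x : V) (l : ℕ) :
    (graphSphere G x l).ncard = (Finset.univ.filter fun u => G.dist x u = l).card := by
  rw [← Set.ncard_coe_finset]
  congr 1
  ext u
  simp [graphSphere]

theorem natCast_mul_rpow_sub_one {m : ℕ} (hm : 1 ≤ m) (β : ℝ) :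
    (m : ℝ) * (m : ℝ) ^ (β - 1) = (m : ℝ) ^ β := by
  have h : (m : ℝ) ≠ 0 := by positivity
  rw [Real.rpow_sub_one h]
  field_simp

theorem SimpleGraph.Connected.card_ball_le (hG : G.Connected) (hβ : 1 ≤ β) (hc : 0 ≤ c) (x : V)
    {m : ℕ} (hm : 1 ≤ m)
    (hs : ∀ l : ℕ, 1 ≤ l → l ≤ m → ((graphSphere G x l).ncard : ℝ) ≤ c * (l : ℝ) ^ (β - 1)) :
    ((Finset.univ.filter fun u => G.dist x u ≤ m).card : ℝ) ≤ 1 + c * (m : ℝ) ^ β := by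
  have hcard : (Finset.univ.filter fun u => G.dist x u ≤ m).card =
      ∑ l ∈ Finset.range (m + 1), (graphSphere G x l).ncard := by
    rw [Finset.card_eq_sum_card_fiberwise (f := fun u => G.dist x u) (t := Finset.range (m + 1))
      fun u hu => by simpa [Nat.lt_succ_iff] using hu]
    refine Finset.sum_congr rfl fun l hl => ?_
    rw [ncard_graphSphere, Finset.filter_filter]
    congr 1
    refine Finset.filter_congr fun u _ => ⟨fun h => h.2, fun h => ⟨?_, h⟩⟩
    have := Finset.mem_range.1 hl
    omega
  rw [hcard, Finset.sum_range_succ', hG.ncard_graphSphere_zero]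
  push_cast
  rw [add_comm]
  gcongr
  calc ∑ l ∈ Finset.range m, ((graphSphere G x (l + 1)).ncard : ℝ)
      ≤ ∑ l ∈ Finset.range m, c * (m : ℝ) ^ (β - 1) := by
        refine Finset.sum_le_sum fun l hl => ?_
        have hl' := Finset.mem_range.1 hl
        refine (hs (l + 1) (by omega) hl').trans ?_
        gcongr
        exact_mod_cast hl'
    _ = c * (m : ℝ) ^ β := by
        rw [Finset.sum_const, Finset.card_range, nsmul_eq_mul, ← natCast_mul_rpow_sub_one hm β]
        ring

/-- The outer half of the spheres already has the volume growth of a ball. -/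
theorem SimpleGraph.le_card_ball (hβ : 1 ≤ β) (hc : 0 ≤ c) (x : V) {ρ : ℕ} (hρ : 1 ≤ ρ)
    (hs : ∀ l : ℕ, 1 ≤ l → l ≤ 2 * ρ → c * (l : ℝ) ^ (β - 1) ≤ ((graphSphere G x l).ncard : ℝ)) :
    c * (ρ : ℝ) ^ β ≤ ((Finset.univ.filter fun u => G.dist x u ≤ 2 * ρ).card : ℝ) := by
  have hcard : ∑ l ∈ Finset.Ioc ρ (2 * ρ), (graphSphere G x l).ncard ≤
      (Finset.univ.filter fun u => G.dist x u ≤ 2 * ρ).card := by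
    refine le_trans (le_of_eq ?_) (Finset.card_le_card (s := Finset.univ.filter fun u =>
      G.dist x u ∈ Finset.Ioc ρ (2 * ρ)) fun u hu => ?_)
    · rw [Finset.card_eq_sum_card_fiberwise (f := fun u => G.dist x u)
        (t := Finset.Ioc ρ (2 * ρ)) fun u hu => by simpa using hu]
      refine Finset.sum_congr rfl fun l hl => ?_
      rw [ncard_graphSphere, Finset.filter_filter]
      congr 1
      exact Finset.filter_congr fun u _ => ⟨fun h => ⟨h ▸ hl, h⟩, fun h => h.2⟩
    · simp only [Finset.mem_filter, Finset.mem_univ, true_and, Finset.mem_Ioc] at hu ⊢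
      exact hu.2
  calc c * (ρ : ℝ) ^ β = ∑ l ∈ Finset.Ioc ρ (2 * ρ), c * (ρ : ℝ) ^ (β - 1) := by
        rw [Finset.sum_const, Nat.card_Ioc, nsmul_eq_mul, ← natCast_mul_rpow_sub_one hρ β]
        have : 2 * ρ - ρ = ρ := by omega
        rw [this]
        ring
    _ ≤ ∑ l ∈ Finset.Ioc ρ (2 * ρ), ((graphSphere G x l).ncard : ℝ) := by
        refine Finset.sum_le_sum fun l hl => ?_
        obtain ⟨h1, h2⟩ := Finset.mem_Ioc.1 hl
        refine le_trans ?_ (hs l (by omega) h2)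
        gcongr
    _ ≤ _ := by exact_mod_cast hcard

/-- The balls of radius `2 ρ` around the points of a `4 ρ`-separated set are disjoint, so volume
bounds the number of these points near a given vertex. -/
theorem SimpleGraph.Connected.card_near_mul_le (hG : G.Connected) {vLow vHigh : ℝ} (hβ : 1 ≤ β)
    (hLow : 0 < vLow) (hHigh : 1 ≤ vHigh) {ρ : ℕ} (hρ : 1 ≤ ρ)
    (hs : ∀ x, ∀ l : ℕ, 1 ≤ l → l ≤ 10 * ρ →
      vLow * (l : ℝ) ^ (β - 1) ≤ ((graphSphere G x l).ncard : ℝ) ∧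
        ((graphSphere G x l).ncard : ℝ) ≤ vHigh * (l : ℝ) ^ (β - 1))
    (X : Finset V) (hX : ∀ x ∈ X, ∀ y ∈ X, x ≠ y → 4 * ρ < G.dist x y) (u : V) :
    ((X.filter fun x => G.dist x u ≤ 2 * (4 * ρ)).card : ℝ) * vLow ≤ 2 * 10 ^ β * vHigh := by
  classical
  set near := X.filter fun x => G.dist x u ≤ 2 * (4 * ρ)
  let ball : V → ℕ → Finset V := fun x m => Finset.univ.filter fun w => G.dist x w ≤ m
  have hdisj : ∑ x ∈ near, (ball x (2 * ρ)).card ≤ (ball u (10 * ρ)).card := by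
    rw [← Finset.card_biUnion]
    · refine Finset.card_le_card fun w hw => ?_
      obtain ⟨x, hx, hw⟩ := Finset.mem_biUnion.1 hw
      have h1 := (Finset.mem_filter.1 hx).2
      have h2 := (Finset.mem_filter.1 hw).2
      have h3 := hG.dist_triangle (u := u) (v := x) (w := w)
      rw [G.dist_comm (u := u) (v := x)] at h3
      exact Finset.mem_filter.2 ⟨Finset.mem_univ _, by omega⟩
    · intro x hx y hy hxy
      refine Finset.disjoint_left.2 fun w hwx hwy => ?_
      have h1 := (Finset.mem_filter.1 hwx).2
      have h2 := (Finset.mem_filter.1 hwy).2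
      have h3 := hG.dist_triangle (u := x) (v := w) (w := y)
      rw [G.dist_comm (u := w) (v := y)] at h3
      have h4 := hX x (Finset.mem_filter.1 hx).1 y (Finset.mem_filter.1 hy).1 hxy
      omega
  have hlow : ∀ x, vLow * (ρ : ℝ) ^ β ≤ ((ball x (2 * ρ)).card : ℝ) := fun x =>
    G.le_card_ball hβ hLow.le x hρ fun l h1 h2 => (hs x l h1 (by omega)).1
  have hup : ((ball u (10 * ρ)).card : ℝ) ≤ 1 + vHigh * ((10 * ρ : ℕ) : ℝ) ^ β :=
    hG.card_ball_le hβ (by linarith) u (by omega) fun l h1 h2 => (hs u l h1 h2).2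
  have hρβ : 0 < (ρ : ℝ) ^ β := by positivity
  have h10 : ((10 * ρ : ℕ) : ℝ) ^ β = 10 ^ β * (ρ : ℝ) ^ β := by
    push_cast
    rw [Real.mul_rpow (by norm_num) (by positivity)]
  have hone : 1 ≤ vHigh * ((10 * ρ : ℕ) : ℝ) ^ β := by
    have h1 : (1 : ℝ) ≤ ((10 * ρ : ℕ) : ℝ) := by exact_mod_cast (by omega : 1 ≤ 10 * ρ)
    exact one_le_mul_of_one_le_of_one_le hHigh (Real.one_le_rpow h1 (by linarith))
  refine le_of_mul_le_mul_right ?_ hρβ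
  calc (near.card : ℝ) * vLow * (ρ : ℝ) ^ β = ∑ x ∈ near, vLow * (ρ : ℝ) ^ β := by
        rw [Finset.sum_const, nsmul_eq_mul, mul_assoc]
    _ ≤ ∑ x ∈ near, ((ball x (2 * ρ)).card : ℝ) := Finset.sum_le_sum fun x _ => hlow x
    _ ≤ ((ball u (10 * ρ)).card : ℝ) := by exact_mod_cast hdisj
    _ ≤ 2 * (vHigh * ((10 * ρ : ℕ) : ℝ) ^ β) := by linarith
    _ = 2 * 10 ^ β * vHigh * (ρ : ℝ) ^ β := by rw [h10]; ring

end Volume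

/-! ### Families with degenerate spheres -/

theorem SimpleGraph.Connected.card_le_two {V : Type*} [Fintype V] {G : SimpleGraph V}
    (hG : G.Connected) (h : ∀ x, (graphSphere G x 1).ncard ≤ 1) : Fintype.card V ≤ 2 := by
  classical
  obtain ⟨x⟩ := hG.nonempty
  have huniq : ∀ w a b, G.Adj w a → G.Adj w b → a = b := fun w a b ha hb =>
    Set.ncard_le_one (Set.toFinite _) |>.1 (h w) a (SimpleGraph.dist_eq_one_iff_adj.2 ha) b
      (SimpleGraph.dist_eq_one_iff_adj.2 hb)
  have hclosed : ∀ u v, G.Walk u v → (x = u ∨ G.Adj x u) → (x = v ∨ G.Adj x v) := by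
    intro u v p
    induction p with
    | nil => exact id
    | cons hadj _ ih =>
      rintro (rfl | hu)
      · exact ih (Or.inr hadj)
      · exact ih (Or.inl (huniq _ _ _ hu.symm hadj))
  have hsub : (Set.univ : Set V) ⊆ {x} ∪ graphSphere G x 1 := fun u _ => by
    obtain ⟨p⟩ := hG.preconnected x u
    rcases hclosed x u p (Or.inl rfl) with rfl | hu
    · exact Or.inl rfl
    · exact Or.inr (SimpleGraph.dist_eq_one_iff_adj.2 hu)
  rw [← Nat.card_eq_fintype_card, ← Set.ncard_univ]
  calc _ ≤ ({x} ∪ graphSphere G x 1).ncard := Set.ncard_le_ncard hsub (Set.toFinite _)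
    _ ≤ _ := Set.ncard_union_le _ _
    _ ≤ 2 := by rw [Set.ncard_singleton]; have := h x; omega

theorem assouadDim_le_zero_of_card_le {I : Type*} {V : I → Type*} [∀ i, Fintype (V i)]
    (G : ∀ i, SimpleGraph (V i)) (N : ℕ) (h : ∀ i, Fintype.card (V i) ≤ N) :
    assouadDim G ≤ 0 := by
  refine sInf_le ⟨0, ⟨N + 1, by positivity, fun i v r R hr _ => ⟨Finset.univ, ?_, ?_⟩⟩, rfl⟩
  · rw [Real.rpow_zero, mul_one, Finset.card_univ]
    exact_mod_cast (h i).trans (Nat.le_succ N)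
  · intro u _
    refine Set.mem_iUnion₂.2 ⟨u, Finset.mem_univ u, ?_⟩
    change ((G i).dist u u : ℝ) ≤ r
    rw [SimpleGraph.dist_self, Nat.cast_zero]
    exact hr.le

/-- In a regular family of positive Assouad dimension the upper constant is at least `1`: otherwise
all spheres of radius one are single points and all the graphs have at most two vertices. -/
theorem StrengthenedAhlforsRegular.one_le_vHigh {I : Type*} {V : I → Type*} [∀ i, Fintype (V i)]
    {G : ∀ i, SimpleGraph (V i)} {β vLow vHigh : ℝ} {scale : I → ℝ}
    (h : StrengthenedAhlforsRegular G β vLow vHigh scale) (hscale : ∀ i, 1 ≤ scale i)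
    (hG : ∀ i, (G i).Connected) (hdim : 0 < assouadDim G) : 1 ≤ vHigh := by
  by_contra! hlt
  refine hdim.not_ge (assouadDim_le_zero_of_card_le G 2 fun i => (hG i).card_le_two fun x => ?_)
  have := (h i x 1 le_rfl (by simpa using hscale i)).2
  rw [Nat.cast_one, Real.one_rpow, mul_one, max_eq_right hlt.le] at this
  exact_mod_cast this

/-! ### The bound for a single code -/

/-- The trade-off in terms of the scale `ρ` of the cells, which is admissible as long as all spheres
up to radius `10 ρ` are smaller than the distance: the net is `4 ρ`-separated, the radii lie in
`[4 ρ, 8 ρ)`, and packing involves balls of radius `8 ρ + 2 ρ`. -/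
theorem StabilizerCode.HasParameters.mul_sq_le {Q : Type*} [Fintype Q] [DecidableEq Q]
    {C : StabilizerCode Q} {k d : ℕ} (hC : C.HasParameters k d)
    (hconn : C.connectivityGraph.Connected) {β vLow vHigh : ℝ} (hβ : 2 ≤ β) (hLow : 0 < vLow)
    (hHigh : 1 ≤ vHigh)
    (hs : ∀ x, ∀ l : ℕ, 1 ≤ l → l ≤ d →
      vLow * (l : ℝ) ^ (β - 1) ≤ ((graphSphere C.connectivityGraph x l).ncard : ℝ) ∧
        ((graphSphere C.connectivityGraph x l).ncard : ℝ) ≤ vHigh * (l : ℝ) ^ (β - 1))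
    {ρ : ℕ} (hρ : 1 ≤ ρ) (hd : vHigh * (10 * ρ : ℝ) ^ (β - 1) < d) :
    (4 * ρ : ℝ) ^ 2 * k ≤ 3 * (2 * 10 ^ β * (vHigh / vLow)) ^ 2 * Fintype.card Q := by
  set G := C.connectivityGraph
  have hρ' : (1 : ℝ) ≤ ρ := by exact_mod_cast hρ
  have hpow : (10 * ρ : ℝ) ≤ (10 * ρ : ℝ) ^ (β - 1) :=
    Real.self_le_rpow_of_one_le (by linarith) (by linarith)
  have hρd : 10 * ρ ≤ d := by
    have : (10 * ρ : ℝ) ≤ d := by nlinarith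
    exact_mod_cast this
  have hd1 : 1 < d := by omega
  obtain ⟨X, hsep, hnet⟩ := G.exists_net (4 * ρ)
  have hnear : ∀ u, (X.filter fun x => G.dist x u ≤ 2 * (4 * ρ)).card ≤
      ⌊2 * 10 ^ β * (vHigh / vLow)⌋₊ := fun u => by
    refine Nat.le_floor ?_
    rw [← mul_div_assoc, le_div_iff₀ hLow]
    exact hconn.card_near_mul_le (by linarith) hLow hHigh hρ
      (fun x l h1 h2 => hs x l h1 (h2.trans hρd)) X hsep u
  obtain ⟨r, hr, hle⟩ := exists_radii_card_sphereOverlap_le G X (by omega : 0 < 4 * ρ) hnear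
  have hk : k ≤ (sphereOverlap G X r).ncard := by
    refine hC.le_ncard_sphereOverlap X hnet r (fun x => (hr x).1) fun x l hl => ?_
    have hl' : l ≤ 10 * ρ := by have := (hr x).2; omega
    rcases Nat.eq_zero_or_pos l with rfl | hl0
    · rwa [hconn.ncard_graphSphere_zero]
    · have hsl := (hs x l hl0 (hl'.trans hρd)).2
      have hmono : (l : ℝ) ^ (β - 1) ≤ (10 * ρ : ℝ) ^ (β - 1) :=
        Real.rpow_le_rpow (by positivity) (by exact_mod_cast hl') (by linarith)
      have : ((graphSphere G x l).ncard : ℝ) < d :=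
        (hsl.trans (mul_le_mul_of_nonneg_left hmono (by linarith))).trans_lt hd
      exact_mod_cast this
  have hle' : ((4 * ρ) ^ 2 * (sphereOverlap G X r).ncard : ℝ) ≤
      3 * (⌊2 * 10 ^ β * (vHigh / vLow)⌋₊ : ℝ) ^ 2 * Fintype.card Q := by exact_mod_cast hle
  have hfloor : (⌊2 * 10 ^ β * (vHigh / vLow)⌋₊ : ℝ) ≤ 2 * 10 ^ β * (vHigh / vLow) :=
    Nat.floor_le (by positivity)
  calc (4 * ρ : ℝ) ^ 2 * k ≤ (4 * ρ : ℝ) ^ 2 * (sphereOverlap G X r).ncard := by gcongr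
    _ ≤ _ := hle'
    _ ≤ _ := by gcongr

theorem StabilizerCode.HasParameters.mul_rpow_le {Q : Type*} [Fintype Q] [DecidableEq Q]
    {C : StabilizerCode Q} {k d : ℕ} (hC : C.HasParameters k d)
    (hconn : C.connectivityGraph.Connected) {β vLow vHigh : ℝ} (hβ : 2 ≤ β) (hLow : 0 < vLow)
    (hLH : vLow ≤ vHigh) (hHigh : 1 ≤ vHigh)
    (hs : ∀ x, ∀ l : ℕ, 1 ≤ l → l ≤ d →
      vLow * (l : ℝ) ^ (β - 1) ≤ ((graphSphere C.connectivityGraph x l).ncard : ℝ) ∧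
        ((graphSphere C.connectivityGraph x l).ncard : ℝ) ≤ vHigh * (l : ℝ) ^ (β - 1)) :
    (k : ℝ) * (d : ℝ) ^ (2 / (β - 1)) ≤
      18 * (400 : ℝ) ^ β * β * (vHigh ^ ((3 * β - 1) / (β - 1)) / vLow ^ 3) * Fintype.card Q := by
  classical
  have hβ1 : 0 < β - 1 := by linarith
  have hV : 0 < vHigh := by linarith
  -- The smallest scale at which the walls may be as large as the distance.
  have hex : ∃ N : ℕ, (d : ℝ) ≤ vHigh * (10 * N : ℝ) ^ (β - 1) := by
    refine ⟨d + 1, ?_⟩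
    push_cast
    have h2 : (0 : ℝ) ≤ d := by positivity
    have h1 : (10 * (d + 1) : ℝ) ≤ (10 * (d + 1) : ℝ) ^ (β - 1) :=
      Real.self_le_rpow_of_one_le (by linarith) (by linarith)
    nlinarith
  obtain ⟨N, hN, hmin⟩ : ∃ N : ℕ, (d : ℝ) ≤ vHigh * (10 * N : ℝ) ^ (β - 1) ∧
      ∀ m < N, vHigh * (10 * m : ℝ) ^ (β - 1) < d :=
    ⟨Nat.find hex, Nat.find_spec hex, fun m hm => not_le.1 (Nat.find_min hex hm)⟩
  have hN0 : 1 ≤ N := by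
    by_contra! h
    have hN' : N = 0 := by omega
    rw [hN', Nat.cast_zero, mul_zero, Real.zero_rpow hβ1.ne', mul_zero] at hN
    have := hC.pos
    have : (0 : ℝ) < d := by exact_mod_cast this
    linarith
  set y := vHigh ^ (2 / (β - 1))
  have hy : 0 < y := by positivity
  have hdy : (d : ℝ) ^ (2 / (β - 1)) ≤ y * (10 * N : ℝ) ^ 2 := by
    calc (d : ℝ) ^ (2 / (β - 1)) ≤ (vHigh * (10 * N : ℝ) ^ (β - 1)) ^ (2 / (β - 1)) := by
          gcongr
      _ = y * (10 * N : ℝ) ^ 2 := by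
          rw [Real.mul_rpow hV.le (by positivity), ← Real.rpow_mul (by positivity),
            mul_div_cancel₀ _ hβ1.ne', Real.rpow_two]
  have hVpow : vHigh ^ ((3 * β - 1) / (β - 1)) = vHigh ^ 3 * y := by
    have : (3 * β - 1) / (β - 1) = (3 : ℕ) + 2 / (β - 1) := by
      field_simp
      push_cast
      ring
    rw [this, Real.rpow_add hV, Real.rpow_natCast]
  set q := vHigh / vLow with hq
  have hq1 : 1 ≤ q := (one_le_div hLow).2 hLH
  set n : ℝ := (Fintype.card Q : ℝ)
  have hn : 0 ≤ n := by positivity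
  have hgoal : 18 * (400 : ℝ) ^ β * β * (vHigh ^ ((3 * β - 1) / (β - 1)) / vLow ^ 3) * n =
      y * n * (18 * (400 : ℝ) ^ β * β * q ^ 3) := by
    rw [hVpow, hq, div_pow]
    ring
  have h400 : (400 : ℝ) ^ β = 4 ^ β * 100 ^ β := by
    rw [← Real.mul_rpow (by norm_num) (by norm_num)]
    norm_num
  have h100 : (100 : ℝ) ^ β = (10 ^ β) ^ 2 := by
    rw [← Real.rpow_natCast, ← Real.rpow_mul (by norm_num), mul_comm, Real.rpow_mul (by norm_num)]
    norm_num
  have h4 : (16 : ℝ) ≤ 4 ^ β := by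
    calc (16 : ℝ) = 4 ^ (2 : ℝ) := by norm_num
      _ ≤ 4 ^ β := Real.rpow_le_rpow_of_exponent_le (by norm_num) hβ
  have h10 : (1 : ℝ) ≤ 10 ^ β := Real.one_le_rpow (by norm_num) (by linarith)
  have hconst : 300 * (100 : ℝ) ^ β * q ^ 2 ≤ 18 * (400 : ℝ) ^ β * β * q ^ 3 := by
    have h1 : q ^ 2 ≤ q ^ 3 := pow_le_pow_right₀ hq1 (by norm_num)
    have h2 : 300 * (100 : ℝ) ^ β ≤ 18 * (400 : ℝ) ^ β * β := by
      have : (32 : ℝ) ≤ 4 ^ β * β := by nlinarith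
      rw [h400]
      have h3 : (0 : ℝ) < 100 ^ β := by positivity
      nlinarith
    exact mul_le_mul h2 h1 (by positivity) (by positivity)
  rw [hgoal]
  obtain ⟨ρ, rfl⟩ : ∃ ρ, N = ρ + 1 := ⟨N - 1, by omega⟩
  rcases Nat.eq_zero_or_pos ρ with rfl | hρ
  · -- No cell fits below the distance; here `k ≤ n` is enough.
    have hkn : (k : ℝ) ≤ n := by
      have := C.finrank_stabilizerSpace_add hC.1
      exact Nat.cast_le.2 (by omega)
    have h1 : (100 : ℝ) ≤ 300 * (100 : ℝ) ^ β * q ^ 2 := by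
      have : (1 : ℝ) ≤ 100 ^ β * q ^ 2 := by
        rw [h100]
        exact one_le_mul_of_one_le_of_one_le (one_le_pow₀ h10) (one_le_pow₀ hq1)
      nlinarith
    norm_num at hdy
    calc (k : ℝ) * (d : ℝ) ^ (2 / (β - 1)) ≤ n * (y * 100) := by gcongr
      _ = y * n * 100 := by ring
      _ ≤ _ := mul_le_mul_of_nonneg_left (h1.trans hconst) (by positivity)
  · have hmain := hC.mul_sq_le hconn hβ hLow hHigh hs hρ (hmin ρ (Nat.lt_succ_self ρ))
    have hρ' : (1 : ℝ) ≤ ρ := by exact_mod_cast hρ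
    push_cast at hdy
    calc (k : ℝ) * (d : ℝ) ^ (2 / (β - 1)) ≤ k * (y * (10 * (ρ + 1)) ^ 2) := by gcongr
      _ ≤ k * (y * (10 * (ρ + ρ)) ^ 2) := by gcongr
      _ = 25 * y * ((4 * ρ : ℝ) ^ 2 * k) := by ring
      _ ≤ 25 * y * (3 * (2 * 10 ^ β * q) ^ 2 * n) := by gcongr
      _ = y * n * (300 * (100 : ℝ) ^ β * q ^ 2) := by rw [h100]; ring
      _ ≤ _ := mul_le_mul_of_nonneg_left hconst (by positivity)

theorem mainTheorem1 (β vLow vHigh : ℝ) (hβ : 2 ≤ β) (hLow : 0 < vLow) (hHigh : vLow ≤ vHigh) :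
    ∃ w : ℝ, 0 < w ∧
      ∀ (I : Type*) (n k d : I → ℕ) (C : ∀ i, StabilizerCode (Fin (n i))),
        (∀ i, (C i).HasParameters (k i) (d i)) →
        (∀ i, (C i).connectivityGraph.Connected) →
        assouadDim (fun i => (C i).connectivityGraph) = (β : EReal) →
        StrengthenedAhlforsRegular (fun i => (C i).connectivityGraph) β vLow vHigh
          (fun i => (d i : ℝ)) →
        ∀ i,
          (k i : ℝ) * (d i : ℝ) ^ (2 / (β - 1)) ≤
              18 * (400 : ℝ) ^ β * β * (vHigh ^ ((3 * β - 1) / (β - 1)) / vLow ^ 3) * (n i : ℝ) ∧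
            w * ((k i : ℝ) * (d i : ℝ) ^ (2 / (β - 1))) ≤ (n i : ℝ) := by
  have hV : 0 < vHigh := hLow.trans_le hHigh
  have hβ0 : 0 < β := by linarith
  set K := 18 * (400 : ℝ) ^ β * β * (vHigh ^ ((3 * β - 1) / (β - 1)) / vLow ^ 3)
  have hK : 0 < K := by positivity
  refine ⟨K⁻¹, inv_pos.2 hK, fun I n k d C hC hconn hdim hreg i => ?_⟩
  have hone : 1 ≤ vHigh := hreg.one_le_vHigh (fun i => by exact_mod_cast (hC i).pos) hconn
    (by rw [hdim]; exact_mod_cast hβ0)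
  have hbound : (k i : ℝ) * (d i : ℝ) ^ (2 / (β - 1)) ≤ K * (n i : ℝ) := by
    have := (hC i).mul_rpow_le (hconn i) hβ hLow hHigh hone fun x l h1 h2 => by
      have hl := hreg i x l h1 (Nat.cast_le.2 h2)
      have h1' : (1 : ℝ) ≤ l := by exact_mod_cast h1
      have hmax : 1 ≤ vHigh * (l : ℝ) ^ (β - 1) :=
        one_le_mul_of_one_le_of_one_le hone (Real.one_le_rpow h1' (by linarith))
      rwa [max_eq_left hmax] at hl
    rwa [Fintype.card_fin] at this
  exact ⟨hbound, by rwa [inv_mul_le_iff₀ hK]⟩
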